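/- All strings are finite binary strings. A real-valued function on a set of finite tuples of strings is lower (upper) semicomputable if its values are limits of nondecreasing (nonincreasing) sequences of rationals computable uniformly in the argument. Let $\mathbf m(x\mid y)$ be a maximal lower semicomputable conditional semimeasure, i.e. a maximal element, up to a constant factor, of the class of lower semicomputable functions $m(x\mid y)\ge 0$ with $\sum_x m(x\mid y)\le 1$ for every $y$. Let $\mathrm{KP}(y\mid x)=\min\{|p| : U(p,x)=y\}$ be the conditional prefix complexity, where $U$ is an optimal prefix-free machine: a computable partial function $U(p,x)$ such that for each $x$ the set of $p$ with $U(p,x)$ defined is prefix-free, and for which this minimum is smallest, up to an additive constant, among all such functions. Such $\mathbf m$ and $U$ exist, and for every choice of them the following holds. (a) Consider the class of symmetric lower semicomputable functions $u(x,y)$ with string arguments and nonnegative real values such that $\sum_y u(x,y)\le 1$ for every $x$. The function $\min(\mathbf m(x\mid y),\mathbf m(y\mid x))$ belongs to this class and is maximal in it: for every $v$ in the class there is $c>0$ with $v(x,y)\le c\cdot\min(\mathbf m(x\mid y),\mathbf m(y\mid x))$ for all $x,y$. Every function of the class that is maximal in this sense coincides with it up to an $O(1)$ factor. (b) In logarithmic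 scale: consider the class of symmetric upper semicomputable functions $D(x,y)$ with string arguments and real values such that $\sum_y 2^{-D(x,y)}\le 1$ for every $x$. The function $\max(\mathrm{KP}(x\mid y),\mathrm{KP}(y\mid x))$ is finite, belongs to this class and is minimal in it: for every $D$ in the class there is $c$ with $\max(\mathrm{KP}(x\mid y),\mathrm{KP}(y\mid x))\le D(x,y)+c$ for all $x,y$. Every function of the class that is minimal in this sense coincides with it up to an $O(1)$ additive term. (c) The two extremal functions correspond to each other: $\min(\mathbf m(x\mid y),\mathbf m(y\mid x))$ and $2^{-\max(\mathrm{KP}(x\mid y),\mathrm{KP}(y\mid x))}$ coincide up to an $O(1)$ factor. -/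

import Mathlib

open Filter Topology

namespace InfoDist

/-- Binary strings. -/
abbrev Str : Type := List Bool

/-- A rational-valued function is computable if its value can be written as a quotient of an
integer and a nonzero natural number that are computable from the argument. -/
def ComputableRat {α : Type} [Primcodable α] (f : α → ℚ) : Prop :=
  ∃ (num : α → ℤ) (den : α → ℕ), Computable num ∧ Computable den ∧
    ∀ a, den a ≠ 0 ∧ f a = (num a : ℚ) / (den a : ℚ)

/-- A real-valued function is lower semicomputable if its values are limits of nondecreasing
sequences of rationals that are computable uniformly in the argument. -/
def LowerSemicomputable {α : Type} [Primcodable α] (f : α → ℝ) : Prop :=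
  ∃ q : α × ℕ → ℚ, ComputableRat q ∧ (∀ a, Monotone fun n => q (a, n)) ∧
    ∀ a, Tendsto (fun n => (q (a, n) : ℝ)) atTop (𝓝 (f a))

/-- A real-valued function is upper semicomputable if its values are limits of nonincreasing
sequences of rationals that are computable uniformly in the argument. -/
def UpperSemicomputable {α : Type} [Primcodable α] (f : α → ℝ) : Prop :=
  ∃ q : α × ℕ → ℚ, ComputableRat q ∧ (∀ a, Antitone fun n => q (a, n)) ∧
    ∀ a, Tendsto (fun n => (q (a, n) : ℝ)) atTop (𝓝 (f a))

/-! ### Conditional semimeasures -/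

/-- Lower semicomputable conditional semimeasures; `m x y` is written `m(x | y)`, so that the
second argument is the condition. -/
structure IsCondSemimeasure (m : Str → Str → ℝ) : Prop where
  lowerSemicomputable : LowerSemicomputable fun p : Str × Str => m p.1 p.2
  nonneg : ∀ x y, 0 ≤ m x y
  summable : ∀ y, Summable fun x => m x y
  sum_le_one : ∀ y, ∑' x, m x y ≤ 1

/-- A lower semicomputable conditional semimeasure that dominates all others up to a constant
factor. -/
def IsMaximalCondSemimeasure (m : Str → Str → ℝ) : Prop :=
  IsCondSemimeasure m ∧
    ∀ m', IsCondSemimeasure m' → ∃ c : ℝ, 0 < c ∧ ∀ x y, m' x y ≤ c * m x y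

/-! ### Conditional prefix complexity -/

/-- Computable partial functions `U(p, x)` of a program `p` and an input `x` such that, for each
input, the set of programs on which `U` is defined is prefix-free. -/
structure IsPrefixFreeMachine (U : Str → Str →. Str) : Prop where
  partrec : Partrec₂ U
  prefixFree : ∀ x p p', (U p x).Dom → (U p' x).Dom → p <+: p' → p = p'

/-- `condComplexity U y x` is the minimal length of a program `p` with `U(p, x) = y`
(and `⊤` if there is none), that is, the complexity of `y` given `x` with respect to `U`. -/
noncomputable def condComplexity (U : Str → Str →. Str) (y x : Str) : ℕ∞ :=
  ⨅ (p : Str) (_ : y ∈ U p x), (p.length : ℕ∞)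

/-- A prefix-free machine whose complexity function is minimal, up to an additive constant, among
all prefix-free machines. The complexity function of such a machine is the conditional prefix
complexity. -/
def IsOptimalPrefixFreeMachine (U : Str → Str →. Str) : Prop :=
  IsPrefixFreeMachine U ∧
    ∀ V, IsPrefixFreeMachine V →
      ∃ c : ℕ, ∀ x y, condComplexity U y x ≤ condComplexity V y x + c

/-- The maximum of the complexities of `x` given `y` and of `y` given `x`. -/
noncomputable def maxComplexity (U : Str → Str →. Str) (x y : Str) : ℕ∞ :=
  max (condComplexity U x y) (condComplexity U y x)

/-! ### The two classes of functions -/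

/-- Symmetric lower semicomputable nonnegative `u` with `∑_y u(x, y) ≤ 1` for all `x`. -/
structure IsSymmSemimeasure (u : Str → Str → ℝ) : Prop where
  symm : ∀ x y, u x y = u y x
  lowerSemicomputable : LowerSemicomputable fun p : Str × Str => u p.1 p.2
  nonneg : ∀ x y, 0 ≤ u x y
  summable : ∀ x, Summable fun y => u x y
  sum_le_one : ∀ x, ∑' y, u x y ≤ 1

/-- A member of the class that dominates all members up to a constant factor. -/
def IsMaximalSymmSemimeasure (u : Str → Str → ℝ) : Prop :=
  IsSymmSemimeasure u ∧
    ∀ v, IsSymmSemimeasure v → ∃ c : ℝ, 0 < c ∧ ∀ x y, v x y ≤ c * u x y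

/-- Symmetric upper semicomputable real-valued `D` with `∑_y 2^(-D(x, y)) ≤ 1` for all `x`. -/
structure IsAdmissibleDistance (D : Str → Str → ℝ) : Prop where
  symm : ∀ x y, D x y = D y x
  upperSemicomputable : UpperSemicomputable fun p : Str × Str => D p.1 p.2
  summable : ∀ x, Summable fun y => (2 : ℝ) ^ (-D x y)
  sum_le_one : ∀ x, ∑' y, (2 : ℝ) ^ (-D x y) ≤ 1

/-- A member of the class that is at most any other member plus a constant. -/
def IsMinimalAdmissibleDistance (D : Str → Str → ℝ) : Prop :=
  IsAdmissibleDistance D ∧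
    ∀ D', IsAdmissibleDistance D' → ∃ c : ℝ, ∀ x y, D x y ≤ D' x y + c

end InfoDist

namespace InfoDist

open Encodable Denumerable Nat.Partrec

/-! ### Dyadic intervals of strings -/

/-! In (a), symmetry does the work: a symmetric `v` with row sums at most one is a conditional
semimeasure in either argument, so it lies below both m(x|y) and m(y|x) up to one constant, hence
below their minimum. The minimum is itself at most m(y|x), which bounds its sum over y. Extremal
elements dominate one another, which gives uniqueness in (a) and (b).

For (b) the same argument needs a Kraft–Chaitin theorem: an enumerable family of requests "a program
of length k for y given x", of total measure at most one for each x, is served by every optimal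
machine up to an additive constant (`condComplexity_univ_le`,
`IsOptimalPrefixFreeMachine.condComplexity_le`). Requests read off another prefix-free machine show
that `univ` is optimal; those read off 2^(-k) < m(y|x) give the coding theorem; those read off upper
approximations to D give minimality. By the coding theorem 2^(-KP) is a maximal conditional
semimeasure, so (c) is an instance of uniqueness in (a).

The machine `univ` lays requests end to end on the half-line: a request of length k arriving after
total measure T owns [T, T + 2^(-k)) and receives a dyadic subinterval of length 2^(-(k+1)). Strings
with disjoint intervals are incomparable, so every code gives a prefix-free machine, even one whose
requests overflow the unit interval, and no code needs trimming. The prefixes 1^e 0 merge these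
machines into one. -/

/-- The number with binary expansion `p`, most significant digit first. -/
def binVal (p : Str) : ℕ := p.foldl (fun n b => 2 * n + b.toNat) 0

@[simp] theorem binVal_concat (p : Str) (b : Bool) :
    binVal (p ++ [b]) = 2 * binVal p + b.toNat := by
  simp [binVal]

theorem exists_binVal_eq {k a : ℕ} (h : a < 2 ^ k) : ∃ p : Str, p.length = k ∧ binVal p = a := by
  induction k generalizing a with
  | zero => exact ⟨[], rfl, by simp at h; simp [binVal, h]⟩
  | succ k ih =>
    obtain ⟨p, hp, hv⟩ := ih (a := a / 2) (by rw [pow_succ] at h; omega)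
    rcases Nat.mod_two_eq_zero_or_one a with h2 | h2
    · exact ⟨p ++ [false], by simp [hp], by simp [hv]; omega⟩
    · exact ⟨p ++ [true], by simp [hp], by simp [hv]; omega⟩

/-- Left end of the dyadic interval of reals whose expansion begins with `p`. -/
noncomputable def leftEnd (p : Str) : ℝ := binVal p * 2⁻¹ ^ p.length

/-- Right end of the dyadic interval of reals whose expansion begins with `p`. -/
noncomputable def rightEnd (p : Str) : ℝ := (binVal p + 1) * 2⁻¹ ^ p.length

theorem leftEnd_lt_rightEnd (p : Str) : leftEnd p < rightEnd p := by
  unfold leftEnd rightEnd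
  have : (0 : ℝ) < 2⁻¹ ^ p.length := by positivity
  nlinarith

/-- Appending a digit selects one half of the interval. Together with `rightEnd_append_le`:
comparable strings have nested intervals. -/
theorem leftEnd_le_append (p r : Str) : leftEnd p ≤ leftEnd (p ++ r) := by
  induction r using List.reverseRecOn with
  | nil => simp
  | append_singleton r b ih =>
    refine ih.trans ?_
    rw [← List.append_assoc]
    have : (0 : ℝ) < 2⁻¹ ^ (p ++ r).length := by positivity
    cases b <;> simp only [leftEnd, binVal_concat, List.length_append, List.length_singleton,
      pow_succ, pow_add] at * <;> push_cast <;> nlinarith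

theorem rightEnd_append_le (p r : Str) : rightEnd (p ++ r) ≤ rightEnd p := by
  induction r using List.reverseRecOn with
  | nil => simp
  | append_singleton r b ih =>
    refine le_trans ?_ ih
    rw [← List.append_assoc]
    have : (0 : ℝ) < 2⁻¹ ^ (p ++ r).length := by positivity
    cases b <;> simp only [rightEnd, binVal_concat, List.length_append, List.length_singleton,
      pow_succ, pow_add, Bool.toNat_false, Bool.toNat_true] at * <;> push_cast <;> nlinarith

/-! ### Self-delimiting indices -/

/-- The string `1^e 0 p`. -/
def withIndex (e : ℕ) (p : Str) : Str := (List.cons true)^[e] (false :: p)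

theorem withIndex_succ (e : ℕ) (p : Str) : withIndex (e + 1) p = true :: withIndex e p := by
  simp [withIndex, Function.iterate_succ_apply']

@[simp] theorem length_withIndex (e : ℕ) (p : Str) :
    (withIndex e p).length = p.length + (e + 1) := by
  induction e with
  | zero => simp [withIndex]
  | succ e ih => simp [withIndex_succ, ih]; omega

theorem withIndex_prefix {e e' : ℕ} {p p' : Str} (h : withIndex e p <+: withIndex e' p') :
    e = e' ∧ p <+: p' := by
  induction e generalizing e' with
  | zero =>
    cases e' with
    | zero => simpa [withIndex, List.cons_prefix_cons] using h
    | succ e' => rw [withIndex_succ] at h; simp [withIndex, List.cons_prefix_cons] at h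
  | succ e ih =>
    cases e' with
    | zero => rw [withIndex_succ] at h; simp [withIndex, List.cons_prefix_cons] at h
    | succ e' =>
      rw [withIndex_succ, withIndex_succ, List.cons_prefix_cons] at h
      simpa using ih h.2

/-! ### Enumeration of requests -/

/-- The `i`-th request for a string and a length, with condition `x`, of the `e`-th enumeration:
each pair accepted by the `e`-th code appears exactly once. -/
def request (e : ℕ) (x : Str) (i : ℕ) : Option (Str × ℕ) :=
  (decode₂ ((Str × ℕ) × ℕ) i).bind fun r =>
    bif ((ofNat Code e).evaln (r.2 + 1) (encode (x, r.1))).isSome &&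
      !((ofNat Code e).evaln r.2 (encode (x, r.1))).isSome then some r.1 else none

theorem request_eq_some {e : ℕ} {x : Str} {i : ℕ} {a : Str × ℕ} :
    request e x i = some a ↔ ∃ s, decode₂ ((Str × ℕ) × ℕ) i = some (a, s) ∧
      ((ofNat Code e).evaln (s + 1) (encode (x, a))).isSome ∧
      ¬ ((ofNat Code e).evaln s (encode (x, a))).isSome := by
  unfold request
  rw [Option.bind_eq_some_iff]
  constructor
  · rintro ⟨⟨b, s⟩, h, h'⟩
    rw [Bool.cond_eq_ite] at h'
    split_ifs at h' with hc
    simp only [Option.some.injEq] at h'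
    subst h'
    simp only [Bool.and_eq_true, Bool.not_eq_true'] at hc
    exact ⟨s, h, hc.1, by simp only [hc.2]; decide⟩
  · rintro ⟨s, h, h1, h2⟩
    refine ⟨(a, s), h, ?_⟩
    rw [Bool.not_eq_true] at h2
    simp only [h1, h2, Bool.not_false, Bool.and_true, cond_true]

theorem evaln_isSome_mono {c : Code} {n s t : ℕ} (h : s ≤ t) (hs : (c.evaln s n).isSome) :
    (c.evaln t n).isSome := by
  obtain ⟨v, hv⟩ := Option.isSome_iff_exists.1 hs
  exact Option.isSome_iff_exists.2 ⟨v, Code.evaln_mono h hv⟩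

/-- Halting is monotone in the step bound, so the bound at which acceptance first shows is unique,
and `decode₂` admits only genuine codes. No pair is charged twice in the total measure. -/
theorem request_injective {e : ℕ} {x : Str} {i j : ℕ} {a : Str × ℕ}
    (hi : request e x i = some a) (hj : request e x j = some a) : i = j := by
  obtain ⟨s, hs, h1, h2⟩ := request_eq_some.1 hi
  obtain ⟨t, ht, h3, h4⟩ := request_eq_some.1 hj
  have hst : s = t := by
    rcases lt_trichotomy s t with h | h | h
    · exact absurd (evaln_isSome_mono h h1) h4
    · exact h
    · exact absurd (evaln_isSome_mono h h3) h2
  subst hst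
  exact (decode₂_eq_some.1 hs).symm.trans (decode₂_eq_some.1 ht)

theorem eval_dom_of_request {e : ℕ} {x : Str} {i : ℕ} {a : Str × ℕ}
    (h : request e x i = some a) : ((ofNat Code e).eval (encode (x, a))).Dom := by
  obtain ⟨s, -, h1, -⟩ := request_eq_some.1 h
  obtain ⟨v, hv⟩ := Option.isSome_iff_exists.1 h1
  exact Part.dom_iff_mem.2 ⟨v, Code.evaln_sound hv⟩

theorem exists_request {e : ℕ} {x : Str} {a : Str × ℕ}
    (h : ((ofNat Code e).eval (encode (x, a))).Dom) : ∃ i, request e x i = some a := by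
  classical
  obtain ⟨v, hv⟩ := Part.dom_iff_mem.1 h
  obtain ⟨k, hk⟩ := Code.evaln_complete.1 hv
  have hex : ∃ k, ((ofNat Code e).evaln k (encode (x, a))).isSome :=
    ⟨k, Option.isSome_iff_exists.2 ⟨v, hk⟩⟩
  -- Nothing halts with bound 0, so the least successful bound has a predecessor, as `request`
  -- demands.
  have h0 : Nat.find hex ≠ 0 := by
    intro h0
    have := Nat.find_spec hex
    rw [h0] at this
    simp [Code.evaln] at this
  obtain ⟨s, hs⟩ := Nat.exists_eq_succ_of_ne_zero h0
  refine ⟨encode (a, s), request_eq_some.2 ⟨s, encodek₂ _, ?_, ?_⟩⟩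
  · have := Nat.find_spec hex
    rwa [hs] at this
  · exact Nat.find_min hex (by omega)

/-! ### Allocation of intervals -/

/-- Numerator and binary exponent of the total measure of the first `i` requests. -/
def total (e : ℕ) (x : Str) (i : ℕ) : ℕ × ℕ :=
  Nat.rec (0, 0) (fun j t => ((request e x j).map fun a =>
    (t.1 * 2 ^ a.2 + 2 ^ t.2, t.2 + a.2)).getD t) i

/-- Total measure of the first `i` requests. -/
noncomputable def totalMeasure (e : ℕ) (x : Str) (i : ℕ) : ℝ :=
  (total e x i).1 * 2⁻¹ ^ (total e x i).2

@[simp] theorem totalMeasure_zero (e : ℕ) (x : Str) : totalMeasure e x 0 = 0 := by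
  simp [totalMeasure, total]

/-- Measure of the `i`-th request. -/
noncomputable def requestMeasure (e : ℕ) (x : Str) (i : ℕ) : ℝ :=
  ((request e x i).map fun a => (2⁻¹ : ℝ) ^ a.2).getD 0

theorem requestMeasure_nonneg (e : ℕ) (x : Str) (i : ℕ) : 0 ≤ requestMeasure e x i := by
  unfold requestMeasure
  cases request e x i <;> simp

theorem totalMeasure_succ (e : ℕ) (x : Str) (i : ℕ) :
    totalMeasure e x (i + 1) = totalMeasure e x i + requestMeasure e x i := by
  have h : total e x (i + 1) = ((request e x i).map fun a =>
    ((total e x i).1 * 2 ^ a.2 + 2 ^ (total e x i).2, (total e x i).2 + a.2)).getD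
      (total e x i) := rfl
  unfold totalMeasure requestMeasure
  rw [h]
  cases request e x i with
  | none => simp
  | some a =>
    simp only [Option.map_some, Option.getD_some, pow_add]
    push_cast
    have h1 : (2 : ℝ) ^ a.2 * 2⁻¹ ^ a.2 = 1 := by rw [← mul_pow]; simp
    have h2 : (2 : ℝ) ^ (total e x i).2 * 2⁻¹ ^ (total e x i).2 = 1 := by rw [← mul_pow]; simp
    linear_combination ((total e x i).1 * 2⁻¹ ^ (total e x i).2 : ℝ) * h1 + (2⁻¹ ^ a.2 : ℝ) * h2

theorem totalMeasure_eq_sum (e : ℕ) (x : Str) (i : ℕ) :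
    totalMeasure e x i = ∑ j ∈ Finset.range i, requestMeasure e x j := by
  induction i with
  | zero => simp
  | succ i ih => rw [totalMeasure_succ, Finset.sum_range_succ, ih]

theorem totalMeasure_mono (e : ℕ) (x : Str) : Monotone (totalMeasure e x) :=
  monotone_nat_of_le_succ fun i => by
    rw [totalMeasure_succ]; linarith [requestMeasure_nonneg e x i]

/-- Left end, in units of `2^(-(k+1))`, of the interval allocated to the `i`-th request. -/
def alloc (e : ℕ) (x : Str) (i k : ℕ) : ℕ :=
  ((total e x i).1 * 2 ^ (k + 1) + 2 ^ (total e x i).2 - 1) / 2 ^ (total e x i).2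

theorem totalMeasure_le_alloc (e : ℕ) (x : Str) (i k : ℕ) :
    totalMeasure e x i ≤ alloc e x i k * 2⁻¹ ^ (k + 1) := by
  unfold totalMeasure alloc
  set N := (total e x i).1
  set M := (total e x i).2
  have hM : 0 < 2 ^ M := by positivity
  have h : N * 2 ^ (k + 1) ≤ (N * 2 ^ (k + 1) + 2 ^ M - 1) / 2 ^ M * 2 ^ M := by
    have := Nat.div_add_mod (N * 2 ^ (k + 1) + 2 ^ M - 1) (2 ^ M)
    have := Nat.mod_lt (N * 2 ^ (k + 1) + 2 ^ M - 1) hM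
    rw [mul_comm _ (2 ^ M)]
    omega
  generalize (N * 2 ^ (k + 1) + 2 ^ M - 1) / 2 ^ M = A at *
  have h' : (N : ℝ) * 2 ^ (k + 1) ≤ A * 2 ^ M := by exact_mod_cast h
  rw [inv_pow, inv_pow, ← div_eq_mul_inv, ← div_eq_mul_inv, div_le_div_iff₀ (by positivity)
    (by positivity)]
  exact h'

/-- Rounding up to a multiple of 2^(-(k+1)) costs at most one cell of that length, and 2^(-k) is two
cells, so a whole cell still fits. This is why allocated strings are one digit longer than
requested. -/
theorem alloc_add_one_le (e : ℕ) (x : Str) (i k : ℕ) :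
    (alloc e x i k + 1) * 2⁻¹ ^ (k + 1) ≤ totalMeasure e x i + 2⁻¹ ^ k := by
  unfold totalMeasure alloc
  set N := (total e x i).1
  set M := (total e x i).2
  have hM : 0 < 2 ^ M := by positivity
  have h : (N * 2 ^ (k + 1) + 2 ^ M - 1) / 2 ^ M * 2 ^ M ≤ N * 2 ^ (k + 1) + 2 ^ M :=
    (Nat.div_mul_le_self _ _).trans (Nat.sub_le _ _)
  generalize (N * 2 ^ (k + 1) + 2 ^ M - 1) / 2 ^ M = A at *
  have h' : (A : ℝ) * 2 ^ M ≤ N * 2 ^ (k + 1) + 2 ^ M := by exact_mod_cast h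
  have h1 : (2 : ℝ) ^ M * 2⁻¹ ^ M = 1 := by rw [← mul_pow]; simp
  have h2 : (2 : ℝ) ^ (k + 1) * 2⁻¹ ^ (k + 1) = 1 := by rw [← mul_pow]; simp
  have h3 := mul_le_mul_of_nonneg_right h'
    (by positivity : (0 : ℝ) ≤ 2⁻¹ ^ M * 2⁻¹ ^ (k + 1))
  have h4 : (2⁻¹ : ℝ) ^ k = 2 * 2⁻¹ ^ (k + 1) := by rw [pow_succ]; ring
  rw [h4]
  have e1 : (A : ℝ) * 2 ^ M * (2⁻¹ ^ M * 2⁻¹ ^ (k + 1)) = A * 2⁻¹ ^ (k + 1) := by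
    linear_combination (A * 2⁻¹ ^ (k + 1) : ℝ) * h1
  have e2 : ((N : ℝ) * 2 ^ (k + 1) + 2 ^ M) * (2⁻¹ ^ M * 2⁻¹ ^ (k + 1)) =
      N * 2⁻¹ ^ M + 2⁻¹ ^ (k + 1) := by
    linear_combination (2⁻¹ ^ (k + 1) : ℝ) * h1 + (N * 2⁻¹ ^ M : ℝ) * h2
  linarith

/-- `p` is the string allocated to the `i`-th request, which asks for `y` and the length `k`. -/
structure IsAllocated (e : ℕ) (x p : Str) (i : ℕ) (y : Str) (k : ℕ) : Prop where
  request_eq : request e x i = some (y, k)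
  length_eq : p.length = k + 1
  binVal_eq : binVal p = alloc e x i k

namespace IsAllocated

variable {e : ℕ} {x p p' : Str} {i i' : ℕ} {y y' : Str} {k k' : ℕ}

theorem totalMeasure_le (h : IsAllocated e x p i y k) : totalMeasure e x i ≤ leftEnd p := by
  rw [leftEnd, h.length_eq, h.binVal_eq]
  exact totalMeasure_le_alloc e x i k

theorem le_totalMeasure (h : IsAllocated e x p i y k) :
    rightEnd p ≤ totalMeasure e x (i + 1) := by
  rw [rightEnd, h.length_eq, h.binVal_eq, totalMeasure_succ, requestMeasure, h.request_eq]
  exact alloc_add_one_le e x i k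

theorem eq_of_prefix (h : IsAllocated e x p i y k) (h' : IsAllocated e x p' i' y' k')
    (hp : p <+: p') : p = p' ∧ y = y' := by
  have hl : leftEnd p ≤ leftEnd p' := by
    obtain ⟨r, rfl⟩ := hp; exact leftEnd_le_append p r
  have hr : rightEnd p' ≤ rightEnd p := by
    obtain ⟨r, rfl⟩ := hp; exact rightEnd_append_le p r
  -- Different requests own disjoint stretches, whereas the interval of `p'` is nondegenerate and
  -- lies inside that of `p`.
  have hi : i = i' := by
    rcases lt_trichotomy i i' with hlt | heq | hlt
    · linarith [h.le_totalMeasure, h'.totalMeasure_le, leftEnd_lt_rightEnd p',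
        totalMeasure_mono e x (Nat.succ_le_of_lt hlt)]
    · exact heq
    · linarith [h'.le_totalMeasure, h.totalMeasure_le, leftEnd_lt_rightEnd p',
        totalMeasure_mono e x (Nat.succ_le_of_lt hlt)]
  subst hi
  have := h.request_eq.symm.trans h'.request_eq
  simp only [Option.some.injEq, Prod.mk.injEq] at this
  exact ⟨hp.eq_of_length (by rw [h.length_eq, h'.length_eq, this.2]), this.1⟩

end IsAllocated

/-! ### Primitive recursiveness of the allocation -/

section Primrec

variable {α : Type} [Primcodable α]

theorem primrec_two_pow {f : α → ℕ} (hf : Primrec f) : Primrec fun a => 2 ^ f a := by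
  have : Primrec fun n : ℕ => 2 ^ n :=
    (Primrec.nat_rec₁ (f := fun _ n => 2 * n) 1
      (Primrec.nat_double.comp Primrec.snd).to₂).of_eq fun n => by
        induction n with
        | zero => rfl
        | succ n ih => simp only [pow_succ, ← ih]; ring
  exact this.comp hf

theorem primrec_binVal : Primrec binVal :=
  Primrec.list_foldl (f := fun p : Str => p) (g := fun _ => 0)
    (h := fun _ s => 2 * s.1 + s.2.toNat) Primrec.id (Primrec.const 0)
    (Primrec.nat_add.comp (Primrec.nat_double.comp (Primrec.fst.comp Primrec.snd))
      ((Primrec.dom_bool Bool.toNat).comp (Primrec.snd.comp Primrec.snd))).to₂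

theorem primrec_withIndex {f : α → ℕ} {g : α → Str} (hf : Primrec f) (hg : Primrec g) :
    Primrec fun a => withIndex (f a) (g a) :=
  Primrec.nat_iterate hf (Primrec.list_cons.comp (Primrec.const false) hg)
    (Primrec.list_cons.comp (Primrec.const true) Primrec.snd).to₂

theorem primrec_request {f : α → ℕ} {g : α → Str} {h : α → ℕ} (hf : Primrec f) (hg : Primrec g)
    (hh : Primrec h) : Primrec fun a => request (f a) (g a) (h a) := by
  have hc : Primrec fun q : α × ((Str × ℕ) × ℕ) => ofNat Code (f q.1) :=
    (Primrec.ofNat Code).comp (hf.comp Primrec.fst)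
  have ha : Primrec fun q : α × ((Str × ℕ) × ℕ) => encode (g q.1, q.2.1) :=
    Primrec.encode.comp ((hg.comp Primrec.fst).pair (Primrec.fst.comp Primrec.snd))
  have hs : Primrec fun q : α × ((Str × ℕ) × ℕ) => q.2.2 := Primrec.snd.comp Primrec.snd
  have h1 : Primrec fun q : α × ((Str × ℕ) × ℕ) =>
      (Code.evaln (q.2.2 + 1) (ofNat Code (f q.1)) (encode (g q.1, q.2.1))).isSome :=
    Primrec.option_isSome.comp
      (Code.primrec_evaln.comp (((Primrec.succ.comp hs).pair hc).pair ha))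
  have h2 : Primrec fun q : α × ((Str × ℕ) × ℕ) =>
      (Code.evaln q.2.2 (ofNat Code (f q.1)) (encode (g q.1, q.2.1))).isSome :=
    Primrec.option_isSome.comp (Code.primrec_evaln.comp ((hs.pair hc).pair ha))
  exact Primrec.option_bind (Primrec.decode₂.comp hh)
    (Primrec.cond (Primrec.and.comp h1 (Primrec.not.comp h2))
      (Primrec.option_some.comp (Primrec.fst.comp Primrec.snd)) (Primrec.const none)).to₂

theorem primrec_total {f : α → ℕ} {g : α → Str} {h : α → ℕ} (hf : Primrec f) (hg : Primrec g)
    (hh : Primrec h) : Primrec fun a => total (f a) (g a) (h a) := by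
  refine Primrec.nat_rec' (f := h) (g := fun _ => ((0, 0) : ℕ × ℕ))
    (h := fun a s => ((request (f a) (g a) s.1).map fun b =>
      (s.2.1 * 2 ^ b.2 + 2 ^ s.2.2, s.2.2 + b.2)).getD s.2) hh (Primrec.const _) ?_
  have hreq : Primrec fun q : α × (ℕ × (ℕ × ℕ)) => request (f q.1) (g q.1) q.2.1 :=
    primrec_request (hf.comp Primrec.fst) (hg.comp Primrec.fst) (Primrec.fst.comp Primrec.snd)
  have ht : Primrec fun q : (α × (ℕ × (ℕ × ℕ))) × (Str × ℕ) => q.1.2.2 :=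
    Primrec.snd.comp (Primrec.snd.comp Primrec.fst)
  have hb : Primrec fun q : (α × (ℕ × (ℕ × ℕ))) × (Str × ℕ) => q.2.2 :=
    Primrec.snd.comp Primrec.snd
  refine Primrec.option_getD.comp (Primrec.option_map hreq ?_) (Primrec.snd.comp Primrec.snd)
  unfold Primrec₂
  exact (Primrec.nat_add.comp
    (Primrec.nat_mul.comp (Primrec.fst.comp ht) (primrec_two_pow hb))
    (primrec_two_pow (Primrec.snd.comp ht))).pair
    (Primrec.nat_add.comp (Primrec.snd.comp ht) hb)

theorem primrec_alloc {f : α → ℕ} {g : α → Str} {h k : α → ℕ} (hf : Primrec f) (hg : Primrec g)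
    (hh : Primrec h) (hk : Primrec k) : Primrec fun a => alloc (f a) (g a) (h a) (k a) := by
  have ht := primrec_total hf hg hh
  have hM := primrec_two_pow (Primrec.snd.comp ht)
  exact Primrec.nat_div.comp (Primrec.nat_sub.comp (Primrec.nat_add.comp
    (Primrec.nat_mul.comp (Primrec.fst.comp ht) (primrec_two_pow (Primrec.succ.comp hk))) hM)
    (Primrec.const 1)) hM

end Primrec

/-! ### The universal machine -/

/-- Output of the universal machine on the program `q` if its run is witnessed by `n`. -/
def univStep (q x : Str) (n : ℕ) : Option Str :=
  (decode (α := ℕ × Str × ℕ) n).bind fun r => (request r.1 x r.2.2).bind fun a =>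
    if (q = withIndex r.1 r.2.1 ∧ r.2.1.length = a.2 + 1) ∧
      binVal r.2.1 = alloc r.1 x r.2.2 a.2 then some a.1 else none

/-- The machine that, on the program `1^e 0 p`, outputs the string whose request, in the `e`-th
enumeration, is allocated the string `p`. -/
def univ (q x : Str) : Part Str := Nat.rfindOpt (univStep q x)

theorem primrec_univStep : Primrec fun a : (Str × Str) × ℕ => univStep a.1.1 a.1.2 a.2 := by
  have he : Primrec fun b : ((Str × Str) × ℕ) × (ℕ × Str × ℕ) => b.2.1 :=
    Primrec.fst.comp Primrec.snd
  have hp : Primrec fun b : ((Str × Str) × ℕ) × (ℕ × Str × ℕ) => b.2.2.1 :=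
    Primrec.fst.comp (Primrec.snd.comp Primrec.snd)
  have hi : Primrec fun b : ((Str × Str) × ℕ) × (ℕ × Str × ℕ) => b.2.2.2 :=
    Primrec.snd.comp (Primrec.snd.comp Primrec.snd)
  have hx : Primrec fun b : ((Str × Str) × ℕ) × (ℕ × Str × ℕ) => b.1.1.2 :=
    Primrec.snd.comp (Primrec.fst.comp Primrec.fst)
  have hq : Primrec fun b : ((Str × Str) × ℕ) × (ℕ × Str × ℕ) => b.1.1.1 :=
    Primrec.fst.comp (Primrec.fst.comp Primrec.fst)
  have hk : Primrec fun c : (((Str × Str) × ℕ) × (ℕ × Str × ℕ)) × (Str × ℕ) => c.2.2 :=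
    Primrec.snd.comp Primrec.snd
  refine Primrec.option_bind (Primrec.decode.comp Primrec.snd) ?_
  unfold Primrec₂
  refine Primrec.option_bind (primrec_request he hx hi) ?_
  unfold Primrec₂
  refine Primrec.ite (((Primrec.eq.comp (hq.comp Primrec.fst)
    (primrec_withIndex (he.comp Primrec.fst) (hp.comp Primrec.fst))).and
    (Primrec.eq.comp (Primrec.list_length.comp (hp.comp Primrec.fst)) (Primrec.succ.comp hk))).and
    (Primrec.eq.comp (primrec_binVal.comp (hp.comp Primrec.fst))
      (primrec_alloc (he.comp Primrec.fst) (hx.comp Primrec.fst) (hi.comp Primrec.fst) hk)))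
    (Primrec.option_some.comp (Primrec.fst.comp Primrec.snd)) (Primrec.const none)

theorem univStep_eq_some {q x y : Str} {n : ℕ} (h : univStep q x n = some y) :
    ∃ e p i k, q = withIndex e p ∧ IsAllocated e x p i y k := by
  obtain ⟨⟨e, p, i⟩, -, h⟩ := Option.bind_eq_some_iff.1 h
  obtain ⟨⟨y', k⟩, hr, h⟩ := Option.bind_eq_some_iff.1 h
  split_ifs at h with hc
  simp only [Option.some.injEq] at h
  subst h
  exact ⟨e, p, i, k, hc.1.1, hr, hc.1.2, hc.2⟩

theorem mem_univ {q x y : Str} :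
    y ∈ univ q x ↔ ∃ e p i k, q = withIndex e p ∧ IsAllocated e x p i y k := by
  constructor
  · intro h
    obtain ⟨n, hn⟩ := Nat.rfindOpt_spec h
    exact univStep_eq_some hn
  · rintro ⟨e, p, i, k, rfl, h⟩
    have hstep : univStep (withIndex e p) x (encode (e, p, i)) = some y := by
      unfold univStep
      rw [encodek, Option.bind_some, h.request_eq, Option.bind_some,
        if_pos ⟨⟨rfl, h.length_eq⟩, h.binVal_eq⟩]
    have hd : (univ (withIndex e p) x).Dom := Nat.rfindOpt_dom.2 ⟨_, y, hstep⟩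
    obtain ⟨y', hy'⟩ := Part.dom_iff_mem.1 hd
    obtain ⟨n, hn⟩ := Nat.rfindOpt_spec hy'
    obtain ⟨e', p', i', k', hq, h'⟩ := univStep_eq_some hn
    -- The search may stop at a different witness, but equal programs have the same index and
    -- string, and these determine the output.
    obtain ⟨rfl, hp⟩ := withIndex_prefix (show withIndex e p <+: withIndex e' p' by rw [hq])
    rwa [(h.eq_of_prefix h' hp).2]

theorem isPrefixFreeMachine_univ : IsPrefixFreeMachine univ where
  partrec := Partrec.rfindOpt primrec_univStep.to_comp.to₂
  prefixFree := by
    intro x q q' hq hq' hp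
    obtain ⟨y, hy⟩ := Part.dom_iff_mem.1 hq
    obtain ⟨y', hy'⟩ := Part.dom_iff_mem.1 hq'
    obtain ⟨e, p, i, k, rfl, h⟩ := mem_univ.1 hy
    obtain ⟨e', p', i', k', rfl, h'⟩ := mem_univ.1 hy'
    obtain ⟨rfl, hpp⟩ := withIndex_prefix hp
    rw [(h.eq_of_prefix h' hpp).1]

/-! ### Complexity and the Kraft inequality -/

theorem condComplexity_le_of_mem {U : Str → Str →. Str} {p x y : Str} (h : y ∈ U p x) :
    condComplexity U y x ≤ p.length :=
  iInf₂_le p h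

theorem exists_mem_of_condComplexity_eq {U : Str → Str →. Str} {x y : Str} {k : ℕ}
    (h : condComplexity U y x = k) : ∃ p, y ∈ U p x ∧ p.length = k := by
  by_contra! hne
  have h1 : ((k + 1 : ℕ) : ℕ∞) ≤ condComplexity U y x := by
    refine le_iInf₂ fun p hp => ?_
    have h2 := condComplexity_le_of_mem hp
    rw [h] at h2
    have h3 := hne p hp
    norm_cast at h2 ⊢
    omega
  rw [h] at h1
  norm_cast at h1
  omega

/-- Without the empty word, a prefix-free set is uniquely decodable: the first codewords of two
equal concatenations are comparable, hence equal. The empty word is a prefix of everything and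
forces a singleton. -/
theorem kraft_inequality {F : Finset Str} (h : ∀ p ∈ F, ∀ q ∈ F, p <+: q → p = q) :
    ∑ p ∈ F, (2⁻¹ : ℝ) ^ p.length ≤ 1 := by
  by_cases hnil : ([] : Str) ∈ F
  · have : F = {[]} := Finset.eq_singleton_iff_unique_mem.2
      ⟨hnil, fun q hq => (h [] hnil q hq List.nil_prefix).symm⟩
    simp [this]
  · have hud : InformationTheory.UniquelyDecodable (F : Set Str) := by
      intro L₁
      induction L₁ with
      | nil =>
        intro L₂ _ h2 heq
        cases L₂ with
        | nil => rfl
        | cons q L₂ =>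
          simp only [List.flatten_nil, List.flatten_cons] at heq
          have : q = [] := (List.append_eq_nil_iff.1 heq.symm).1
          exact absurd (this ▸ h2 q (by simp)) hnil
      | cons p L₁ ih =>
        intro L₂ h1 h2 heq
        cases L₂ with
        | nil =>
          simp only [List.flatten_nil, List.flatten_cons] at heq
          have : p = [] := (List.append_eq_nil_iff.1 heq).1
          exact absurd (this ▸ h1 p (by simp)) hnil
        | cons q L₂ =>
          simp only [List.flatten_cons] at heq
          have hp : p ∈ F := h1 p (by simp)
          have hq : q ∈ F := h2 q (by simp)
          have hpq : p = q := by
            rcases List.prefix_or_prefix_of_prefix (heq ▸ List.prefix_append p L₁.flatten)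
              (List.prefix_append q L₂.flatten) with hh | hh
            · exact h p hp q hq hh
            · exact (h q hq p hp hh).symm
          subst hpq
          rw [ih L₂ (fun w hw => h1 w (by simp [hw])) (fun w hw => h2 w (by simp [hw]))
            (List.append_cancel_left heq)]
    simpa using InformationTheory.kraft_mcmillan_inequality hud

theorem IsPrefixFreeMachine.kraft {U : Str → Str →. Str} (hU : IsPrefixFreeMachine U) (x : Str)
    {ι : Type} {F : Finset ι} {p : ι → Str} (hp : ∀ i ∈ F, (U (p i) x).Dom)
    (hinj : Set.InjOn p F) : ∑ i ∈ F, (2⁻¹ : ℝ) ^ (p i).length ≤ 1 := by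
  classical
  rw [← Finset.sum_image (f := fun p : Str => (2⁻¹ : ℝ) ^ p.length) hinj]
  refine kraft_inequality fun q hq q' hq' => ?_
  obtain ⟨i, hi, rfl⟩ := Finset.mem_image.1 hq
  obtain ⟨j, hj, rfl⟩ := Finset.mem_image.1 hq'
  exact hU.prefixFree x _ _ (hp i hi) (hp j hj)

/-! ### Requests -/

/-- Enumerable families of requests whose total measure is at most one. -/
structure IsRequestFamily (P : Str → Str → ℕ → Prop) : Prop where
  re : ∃ f : (Str × Str × ℕ) × ℕ → Bool, Computable f ∧
    ∀ x y k, P x y k ↔ ∃ n, f ((x, y, k), n) = true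
  sum_le_one : ∀ x, ∀ F : Finset (Str × ℕ), (∀ a ∈ F, P x a.1 a.2) →
    ∑ a ∈ F, (2⁻¹ : ℝ) ^ a.2 ≤ 1

theorem exists_code_of_isRequestFamily {P : Str → Str → ℕ → Prop} (hP : IsRequestFamily P) :
    ∃ e, ∀ (x : Str) (a : Str × ℕ), P x a.1 a.2 ↔ ((ofNat Code e).eval (encode (x, a))).Dom := by
  obtain ⟨f, hf, hfP⟩ := hP.re
  have hpart : Partrec fun a : Str × Str × ℕ => Nat.rfind fun n => Part.some (f (a, n)) :=
    Partrec.rfind (Computable.partrec hf).to₂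
  obtain ⟨c, hc⟩ := Code.exists_code.1 hpart
  refine ⟨encode c, fun x a => ?_⟩
  rw [ofNat_encode, hc, hfP]
  simp only [encodek, Part.coe_some, Part.bind_some, Part.map_Dom]
  refine Iff.trans ?_ Nat.rfind_dom.symm
  constructor
  · rintro ⟨n, hn⟩
    exact ⟨n, by simp [hn], by simp⟩
  · rintro ⟨n, hn, -⟩
    exact ⟨n, (Part.mem_some_iff.1 hn).symm⟩

/-- Indices carrying a request map injectively to accepted pairs, so each partial total is a sum
over a finite part of the family. The default `([], 0)` occurs only at indices that are filtered
out. -/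
theorem totalMeasure_le_one {P : Str → Str → ℕ → Prop} (hP : IsRequestFamily P) {e : ℕ}
    (he : ∀ (x : Str) (a : Str × ℕ), P x a.1 a.2 ↔ ((ofNat Code e).eval (encode (x, a))).Dom) (x : Str) (i : ℕ) :
    totalMeasure e x i ≤ 1 := by
  classical
  rw [totalMeasure_eq_sum]
  have hsome : ∀ j ∈ (Finset.range i).filter (fun j => (request e x j).isSome),
      request e x j = some ((request e x j).getD ([], 0)) := by
    intro j hj
    obtain ⟨a, ha⟩ := Option.isSome_iff_exists.1 (Finset.mem_filter.1 hj).2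
    simp [ha]
  have hfilter : ∑ j ∈ Finset.range i, requestMeasure e x j =
      ∑ j ∈ (Finset.range i).filter (fun j => (request e x j).isSome),
        (2⁻¹ : ℝ) ^ ((request e x j).getD ([], 0)).2 := by
    rw [Finset.sum_filter]
    refine Finset.sum_congr rfl fun j _ => ?_
    unfold requestMeasure
    cases request e x j <;> simp
  rw [hfilter]
  have hinj : Set.InjOn (fun j => (request e x j).getD ([], 0))
      ((Finset.range i).filter (fun j => (request e x j).isSome)) := by
    intro j hj j' hj' hjj
    simp only at hjj
    exact request_injective (hsome j hj) (hjj ▸ hsome j' hj')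
  rw [← Finset.sum_image (f := fun a : Str × ℕ => (2⁻¹ : ℝ) ^ a.2) hinj]
  refine hP.sum_le_one x _ fun a ha => ?_
  obtain ⟨j, hj, rfl⟩ := Finset.mem_image.1 ha
  exact (he x _).2 (eval_dom_of_request (hsome j hj))

theorem condComplexity_univ_le {P : Str → Str → ℕ → Prop} (hP : IsRequestFamily P) :
    ∃ c : ℕ, ∀ x y k, P x y k → condComplexity univ y x ≤ (k + c : ℕ) := by
  obtain ⟨e, he⟩ := exists_code_of_isRequestFamily hP
  -- The prefix 1^e 0 costs e + 1 digits and rounding to a dyadic cell costs one more.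
  refine ⟨e + 2, fun x y k h => ?_⟩
  obtain ⟨i, hi⟩ := exists_request (a := (y, k)) ((he x (y, k)).1 h)
  have hle := totalMeasure_le_one hP he x (i + 1)
  rw [totalMeasure_succ, requestMeasure, hi] at hle
  -- The bound on total measure keeps the cell inside [0, 1], so some string of length k + 1 names
  -- it.
  have hlt : alloc e x i k < 2 ^ (k + 1) := by
    have h1 := (alloc_add_one_le e x i k).trans hle
    rw [inv_pow, ← div_eq_mul_inv, div_le_one (by positivity)] at h1
    exact_mod_cast h1
  obtain ⟨p, hp, hv⟩ := exists_binVal_eq hlt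
  refine (condComplexity_le_of_mem (mem_univ.2 ⟨e, p, i, k, rfl, hi, hp, hv⟩)).trans ?_
  rw [length_withIndex, hp]
  norm_cast
  omega

/-- The computation of `y` from `x` by a program of length `k`, as a family of requests. -/
theorem IsPrefixFreeMachine.isRequestFamily {V : Str → Str →. Str} (hV : IsPrefixFreeMachine V) :
    IsRequestFamily fun x y k => ∃ p, y ∈ V p x ∧ p.length = k where
  re := by
    obtain ⟨c, hc⟩ := Code.exists_code.1 hV.partrec
    have hmem : ∀ p x y, y ∈ V p x ↔ ∃ s, c.evaln s (encode (p, x)) = some (encode y) := by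
      intro p x y
      have h1 := @Code.evaln_complete c (encode (p, x)) (encode y)
      simp only [Option.mem_def] at h1
      rw [← h1, hc]
      simp [encodek]
    refine ⟨fun a => ((decode (α := Str × ℕ) a.2).map fun r =>
      decide (c.evaln r.2 (encode (r.1, a.1.1)) = some (encode a.1.2.1) ∧
        r.1.length = a.1.2.2)).getD false, ?_, ?_⟩
    · refine Primrec.to_comp (Primrec.option_getD.comp
        (Primrec.option_map (Primrec.decode.comp Primrec.snd) ?_) (Primrec.const false))
      unfold Primrec₂
      have hr : Primrec fun b : ((Str × Str × ℕ) × ℕ) × (Str × ℕ) => b.2 := Primrec.snd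
      have ha : Primrec fun b : ((Str × Str × ℕ) × ℕ) × (Str × ℕ) => b.1.1 :=
        Primrec.fst.comp Primrec.fst
      refine PrimrecPred.decide (PrimrecPred.and (Primrec.eq.comp (Code.primrec_evaln.comp
        (((Primrec.snd.comp hr).pair (Primrec.const c)).pair
          (Primrec.encode.comp ((Primrec.fst.comp hr).pair (Primrec.fst.comp ha)))))
        (Primrec.option_some.comp (Primrec.encode.comp (Primrec.fst.comp (Primrec.snd.comp ha)))))
        (Primrec.eq.comp (Primrec.list_length.comp (Primrec.fst.comp hr))
          (Primrec.snd.comp (Primrec.snd.comp ha))))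
    · intro x y k
      constructor
      · rintro ⟨p, hp, hk⟩
        obtain ⟨s, hs⟩ := (hmem p x y).1 hp
        refine ⟨encode (p, s), ?_⟩
        simp only [encodek, Option.map_some, Option.getD_some, decide_eq_true_eq]
        exact ⟨hs, hk⟩
      · rintro ⟨n, hn⟩
        cases hd : decode (α := Str × ℕ) n with
        | none => simp [hd] at hn
        | some r =>
          simp only [hd, Option.map_some, Option.getD_some, decide_eq_true_eq] at hn
          exact ⟨r.1, (hmem _ _ _).2 ⟨r.2, hn.1⟩, hn.2⟩
  sum_le_one := by
    classical
    intro x F hF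
    -- One program is chosen for each pair; it determines its output and its length, so the choice
    -- is injective and Kraft applies.
    choose! p hp hk using hF
    calc ∑ a ∈ F, (2⁻¹ : ℝ) ^ a.2 = ∑ a ∈ F, (2⁻¹ : ℝ) ^ (p a).length :=
          Finset.sum_congr rfl fun a ha => by rw [hk a ha]
      _ ≤ 1 := hV.kraft x (fun a ha => Part.dom_iff_mem.2 ⟨_, hp a ha⟩) fun a ha b hb hab => by
          refine Prod.ext (Part.mem_unique (hp a ha) (hab ▸ hp b hb)) ?_
          rw [← hk a ha, ← hk b hb, hab]

theorem isOptimalPrefixFreeMachine_univ : IsOptimalPrefixFreeMachine univ := by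
  refine ⟨isPrefixFreeMachine_univ, fun V hV => ?_⟩
  obtain ⟨c, hc⟩ := condComplexity_univ_le hV.isRequestFamily
  refine ⟨c, fun x y => ?_⟩
  cases h : condComplexity V y x with
  | top => simp
  | coe k => exact_mod_cast hc x y k (exists_mem_of_condComplexity_eq h)

theorem IsOptimalPrefixFreeMachine.condComplexity_le {U : Str → Str →. Str}
    (hU : IsOptimalPrefixFreeMachine U) {P : Str → Str → ℕ → Prop} (hP : IsRequestFamily P) :
    ∃ c : ℕ, ∀ x y k, P x y k → condComplexity U y x ≤ (k + c : ℕ) := by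
  obtain ⟨c, hc⟩ := condComplexity_univ_le hP
  obtain ⟨d, hd⟩ := hU.2 univ isPrefixFreeMachine_univ
  refine ⟨c + d, fun x y k h => (hd x y).trans ?_⟩
  rw [← add_assoc, Nat.cast_add]
  gcongr
  exact hc x y k h

/-! ### Semicomputability -/

theorem primrec_int_toNat : Primrec Int.toNat := by
  have h : Primrec fun z : ℤ => if (encode z).bodd then 0 else (encode z).div2 :=
    Primrec.ite (Primrec.eq.comp (Primrec.nat_bodd.comp Primrec.encode) (Primrec.const true))
      (Primrec.const 0) (Primrec.nat_div2.comp Primrec.encode)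
  refine h.of_eq fun z => ?_
  cases z with
  | ofNat n =>
    have : encode (Int.ofNat n) = 2 * n := rfl
    rw [this]
    simp
  | negSucc n =>
    have : encode (Int.negSucc n) = 2 * n + 1 := rfl
    rw [this]
    simp

theorem primrec_int_ofNat : Primrec Int.ofNat :=
  Primrec.encode_iff.1 (Primrec.nat_double.of_eq fun _ => rfl)

section Semicomputable

variable {α : Type} [Primcodable α]

theorem computableRat_of_nat {num den : α → ℕ} (hn : Computable num) (hd : Computable den)
    (h0 : ∀ a, den a ≠ 0) : ComputableRat fun a => (num a : ℚ) / den a :=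
  ⟨fun a => Int.ofNat (num a), den, primrec_int_ofNat.to_comp.comp hn, hd, fun a => ⟨h0 a, by simp⟩⟩

/-- Clipping the approximations at 0 keeps them nondecreasing with the same nonnegative limit, and
leaves only natural-number arithmetic. -/
theorem LowerSemicomputable.exists_nat {f : α → ℝ} (hf : LowerSemicomputable f)
    (h0 : ∀ a, 0 ≤ f a) : ∃ num den : α × ℕ → ℕ, Computable num ∧ Computable den ∧
      (∀ a, den a ≠ 0) ∧ (∀ a, Monotone fun n => (num (a, n) / den (a, n) : ℚ)) ∧
      ∀ a, Tendsto (fun n => (((num (a, n) / den (a, n) : ℚ)) : ℝ)) atTop (𝓝 (f a)) := by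
  obtain ⟨q, ⟨num, den, hn, hd, hq⟩, hmono, hlim⟩ := hf
  have hmax : ∀ b, ((num b).toNat / den b : ℚ) = max (q b) 0 := by
    intro b
    rw [(hq b).2, ← Int.cast_natCast (R := ℚ), Int.toNat_eq_max, Int.cast_max, Int.cast_zero,
      ← max_div_div_right (Nat.cast_nonneg (den b)), zero_div]
  refine ⟨fun b => (num b).toNat, den, primrec_int_toNat.to_comp.comp hn, hd, fun b => (hq b).1,
    fun a => ?_, fun a => ?_⟩
  · simp only [hmax]
    exact fun i j hij => max_le_max_right 0 (hmono a hij)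
  · simp only [hmax, Rat.cast_max, Rat.cast_zero]
    simpa [max_eq_left (h0 a)] using (hlim a).max (tendsto_const_nhds (x := (0 : ℝ)))

theorem LowerSemicomputable.comp {β : Type} [Primcodable β] {f : α → ℝ}
    (hf : LowerSemicomputable f) {g : β → α} (hg : Computable g) :
    LowerSemicomputable fun b => f (g b) := by
  obtain ⟨q, ⟨num, den, hn, hd, hq⟩, hmono, hlim⟩ := hf
  have h : Computable fun b : β × ℕ => (g b.1, b.2) := (hg.comp Computable.fst).pair Computable.snd
  exact ⟨fun b => q (g b.1, b.2), ⟨_, _, hn.comp h, hd.comp h, fun b => hq _⟩,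
    fun b => hmono (g b), fun b => hlim (g b)⟩

theorem lowerSemicomputable_min {f g : α → ℝ} (hf : LowerSemicomputable f)
    (hg : LowerSemicomputable g) (hf0 : ∀ a, 0 ≤ f a) (hg0 : ∀ a, 0 ≤ g a) :
    LowerSemicomputable fun a => min (f a) (g a) := by
  obtain ⟨n₁, d₁, hn₁, hd₁, h₁, hm₁, hl₁⟩ := hf.exists_nat hf0
  obtain ⟨n₂, d₂, hn₂, hd₂, h₂, hm₂, hl₂⟩ := hg.exists_nat hg0
  have hmul {u v : α × ℕ → ℕ} (hu : Computable u) (hv : Computable v) :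
      Computable fun b => u b * v b :=
    Primrec.nat_mul.to_comp.comp hu hv
  have hmin : ∀ b, ((min (n₁ b * d₂ b) (n₂ b * d₁ b) : ℕ) / (d₁ b * d₂ b : ℕ) : ℚ) =
      min (n₁ b / d₁ b : ℚ) (n₂ b / d₂ b) := by
    intro b
    have e₁ : (d₁ b : ℚ) ≠ 0 := Nat.cast_ne_zero.2 (h₁ b)
    have e₂ : (d₂ b : ℚ) ≠ 0 := Nat.cast_ne_zero.2 (h₂ b)
    rw [Nat.cast_min, ← min_div_div_right (Nat.cast_nonneg _)]
    push_cast
    congr 1 <;> field_simp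
  refine ⟨_, computableRat_of_nat (Primrec.nat_min.to_comp.comp (hmul hn₁ hd₂) (hmul hn₂ hd₁))
    (hmul hd₁ hd₂) fun b => mul_ne_zero (h₁ b) (h₂ b), fun a => ?_, fun a => ?_⟩
  · simp only [hmin]
    exact fun i j hij => min_le_min (hm₁ a hij) (hm₂ a hij)
  · simp only [hmin, Rat.cast_min]
    exact (hl₁ a).min (hl₂ a)

theorem computable_lt_decide {u v : α → ℕ} (hu : Computable u) (hv : Computable v) :
    Computable fun a => decide (u a < v a) :=
  (Primrec₂.to_comp (Primrec.nat_lt.decide)).comp hu hv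

theorem LowerSemicomputable.two_inv_pow_lt {f : α → ℝ} (hf : LowerSemicomputable f)
    (h0 : ∀ a, 0 ≤ f a) : ∃ g : (α × ℕ) × ℕ → Bool, Computable g ∧
      ∀ a k, 2⁻¹ ^ k < f a ↔ ∃ n, g ((a, k), n) = true := by
  obtain ⟨num, den, hn, hd, hne, hmono, hlim⟩ := hf.exists_nat h0
  have hb : Computable fun b : (α × ℕ) × ℕ => (b.1.1, b.2) :=
    (Computable.fst.comp Computable.fst).pair Computable.snd
  have hpow : Computable fun b : (α × ℕ) × ℕ => 2 ^ b.1.2 :=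
    (primrec_two_pow (Primrec.snd.comp Primrec.fst)).to_comp
  refine ⟨fun b => decide (den (b.1.1, b.2) < num (b.1.1, b.2) * 2 ^ b.1.2),
    computable_lt_decide (hd.comp hb) (Primrec.nat_mul.to_comp.comp (hn.comp hb) hpow),
    fun a k => ?_⟩
  have hiff : ∀ n, den (a, n) < num (a, n) * 2 ^ k ↔
      (2⁻¹ : ℝ) ^ k < ((num (a, n) / den (a, n) : ℚ) : ℝ) := by
    intro n
    have hpos : (0 : ℝ) < den (a, n) := by exact_mod_cast Nat.pos_of_ne_zero (hne (a, n))
    push_cast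
    rw [inv_pow, lt_div_iff₀ hpos, inv_mul_lt_iff₀ (by positivity), mul_comm]
    exact_mod_cast Iff.rfl
  simp only [decide_eq_true_eq, hiff]
  constructor
  · exact fun h => ((hlim a).eventually (lt_mem_nhds h)).exists
  · rintro ⟨n, hlt⟩
    refine hlt.trans_le (Monotone.ge_of_tendsto (fun i j hij => ?_) (hlim a) n)
    exact_mod_cast hmono a hij

/-- The test asks whether some approximation is at most k. It may also accept when D equals k, hence
the two one-sided implications. -/
theorem UpperSemicomputable.exists_le {D : α → ℝ} (hD : UpperSemicomputable D) :
    ∃ g : (α × ℕ) × ℕ → Bool, Computable g ∧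
      ∀ a (k : ℕ), (D a < k → ∃ n, g ((a, k), n) = true) ∧
        ((∃ n, g ((a, k), n) = true) → D a ≤ k) := by
  obtain ⟨q, ⟨num, den, hn, hd, hq⟩, hanti, hlim⟩ := hD
  have hb : Computable fun b : (α × ℕ) × ℕ => (b.1.1, b.2) :=
    (Computable.fst.comp Computable.fst).pair Computable.snd
  -- Truncating a negative numerator to 0 does not affect comparison with k ≥ 0 because the
  -- inequality tested is non-strict; the added 1 expresses this with `<`.
  refine ⟨fun b => decide ((num (b.1.1, b.2)).toNat < b.1.2 * den (b.1.1, b.2) + 1),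
    computable_lt_decide (primrec_int_toNat.to_comp.comp (hn.comp hb))
      (Computable.succ.comp (Primrec.nat_mul.to_comp.comp
        (Computable.snd.comp Computable.fst) (hd.comp hb))), fun a k => ?_⟩
  have hiff : ∀ n, (num (a, n)).toNat < k * den (a, n) + 1 ↔ (q (a, n) : ℝ) ≤ k := by
    intro n
    have hpos : (0 : ℝ) < den (a, n) := by exact_mod_cast Nat.pos_of_ne_zero (hq (a, n)).1
    rw [(hq (a, n)).2, Nat.lt_succ_iff, Int.toNat_le]
    push_cast
    rw [div_le_iff₀ hpos]
    exact_mod_cast Iff.rfl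
  simp only [decide_eq_true_eq, hiff]
  constructor
  · exact fun h => (((hlim a).eventually (gt_mem_nhds h)).exists).imp fun n hn => hn.le
  · rintro ⟨n, hle⟩
    refine le_trans (Antitone.le_of_tendsto (fun i j hij => ?_) (hlim a) n) hle
    exact_mod_cast hanti a hij

end Semicomputable

/-! ### Requests below a semimeasure -/

theorem sum_two_inv_pow_le {K : Finset ℕ} {m : ℕ} (h : ∀ k ∈ K, m ≤ k) :
    ∑ k ∈ K, (2⁻¹ : ℝ) ^ k ≤ 2 * 2⁻¹ ^ m := by
  have hsub : K ⊆ Finset.Ico m (m + (K.sup id + 1)) := fun k hk => by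
    have : k ≤ K.sup id := Finset.le_sup (f := id) hk
    simp only [Finset.mem_Ico]
    exact ⟨h k hk, by omega⟩
  calc ∑ k ∈ K, (2⁻¹ : ℝ) ^ k
      ≤ ∑ k ∈ Finset.Ico m (m + (K.sup id + 1)), (2⁻¹ : ℝ) ^ k :=
        Finset.sum_le_sum_of_subset_of_nonneg hsub fun _ _ _ => by positivity
    _ = 2⁻¹ ^ m * ∑ i ∈ Finset.range (K.sup id + 1), (1 / 2 : ℝ) ^ i := by
        rw [Finset.sum_Ico_eq_sum_range, Finset.mul_sum]
        simp [pow_add]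
    _ ≤ 2 * 2⁻¹ ^ m := by
        rw [mul_comm]
        exact mul_le_mul_of_nonneg_right (sum_geometric_two_le _) (by positivity)

/-- The sum is at most twice its largest term, and the shift of each length by one pays for that
factor 2. -/
theorem sum_two_inv_pow_succ_le {K : Finset ℕ} {w : ℝ} (h0 : 0 ≤ w)
    (h : ∀ k ∈ K, 1 ≤ k ∧ (2⁻¹ : ℝ) ^ (k - 1) ≤ w) : ∑ k ∈ K, (2⁻¹ : ℝ) ^ k ≤ w := by
  rcases K.eq_empty_or_nonempty with rfl | hne
  · simpa using h0
  · obtain ⟨h1, h2⟩ := h _ (K.min'_mem hne)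
    refine (sum_two_inv_pow_le (m := K.min' hne) fun k hk => K.min'_le k hk).trans (le_trans (le_of_eq ?_) h2)
    conv_lhs => rw [← Nat.sub_add_cancel h1, pow_succ]
    ring

/-- Requests of lengths bounded below by the logarithm of a semimeasure, increased by one. -/
theorem isRequestFamily_succ {P : Str → Str → ℕ → Prop}
    (re : ∃ f : (Str × Str × ℕ) × ℕ → Bool, Computable f ∧
      ∀ x y k, P x y k ↔ ∃ n, f ((x, y, k), n) = true)
    {w : Str → Str → ℝ} (h0 : ∀ x y, 0 ≤ w x y) (hs : ∀ x, Summable (w x))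
    (h1 : ∀ x, ∑' y, w x y ≤ 1) (hP : ∀ x y k, P x y k → (2⁻¹ : ℝ) ^ k ≤ w x y) :
    IsRequestFamily fun x y k => 1 ≤ k ∧ P x y (k - 1) where
  re := by
    obtain ⟨f, hf, hfP⟩ := re
    refine ⟨fun b => decide (0 < b.1.2.2) && f ((b.1.1, b.1.2.1, b.1.2.2 - 1), b.2), ?_, ?_⟩
    · have hk : Computable fun b : (Str × Str × ℕ) × ℕ => b.1.2.2 :=
        Computable.snd.comp (Computable.snd.comp Computable.fst)
      refine Primrec.and.to_comp.comp (computable_lt_decide (Computable.const 0) hk)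
        (hf.comp (((Computable.fst.comp Computable.fst).pair
          ((Computable.fst.comp (Computable.snd.comp Computable.fst)).pair ?_)).pair
            Computable.snd))
      exact Primrec.nat_sub.to_comp.comp hk (Computable.const 1)
    · intro x y k
      simp only [hfP, Bool.and_eq_true, decide_eq_true_eq, exists_and_left, Nat.succ_le_iff]
  sum_le_one := by
    classical
    intro x F hF
    calc ∑ a ∈ F, (2⁻¹ : ℝ) ^ a.2
        = ∑ y ∈ F.image Prod.fst, ∑ a ∈ F with a.1 = y, (2⁻¹ : ℝ) ^ a.2 :=
          (Finset.sum_fiberwise_of_maps_to (fun a ha => Finset.mem_image_of_mem _ ha) _).symm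
      _ ≤ ∑ y ∈ F.image Prod.fst, w x y := by
          refine Finset.sum_le_sum fun y _ => ?_
          have hinj : Set.InjOn Prod.snd (F.filter fun a => a.1 = y : Set (Str × ℕ)) := by
            intro a ha b hb hab
            simp only [Finset.coe_filter, Set.mem_ofPred_eq] at ha hb
            exact Prod.ext (ha.2.trans hb.2.symm) hab
          rw [← Finset.sum_image (f := fun k : ℕ => (2⁻¹ : ℝ) ^ k) hinj]
          refine sum_two_inv_pow_succ_le (h0 x y) fun k hk => ?_
          obtain ⟨a, ha, rfl⟩ := Finset.mem_image.1 hk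
          obtain ⟨haF, rfl⟩ := Finset.mem_filter.1 ha
          exact ⟨(hF a haF).1, hP _ _ _ (hF a haF).2⟩
      _ ≤ ∑' y, w x y := (hs x).sum_le_tsum _ fun y _ => h0 x y
      _ ≤ 1 := h1 x

/-- Supplies a computable upper bound for the complexity: it yields finiteness and the starting
value of the approximations from above. -/
theorem isRequestFamily_encode : IsRequestFamily fun _ y k => k = encode y + 1 where
  re := ⟨fun b => decide (b.1.2.2 = encode b.1.2.1 + 1), Primrec.to_comp (PrimrecPred.decide
      (Primrec.eq.comp (Primrec.snd.comp (Primrec.snd.comp Primrec.fst))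
        (Primrec.succ.comp (Primrec.encode.comp
          (Primrec.fst.comp (Primrec.snd.comp Primrec.fst)))))), by simp⟩
  sum_le_one := by
    classical
    intro _ F hF
    have hinj : Set.InjOn Prod.snd (F : Set (Str × ℕ)) := by
      intro a ha b hb hab
      refine Prod.ext (encode_injective ?_) hab
      have := hF a ha
      have := hF b hb
      omega
    rw [← Finset.sum_image (f := fun k : ℕ => (2⁻¹ : ℝ) ^ k) hinj]
    refine (sum_two_inv_pow_le (m := 1) fun k hk => ?_).trans (by norm_num)
    obtain ⟨a, ha, rfl⟩ := Finset.mem_image.1 hk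
    rw [hF a ha]
    omega

/-! ### Complexity with respect to an optimal machine -/

/-- The complexity of `y` given `x` as a natural number. -/
noncomputable def natComplexity (U : Str → Str →. Str) (y x : Str) : ℕ :=
  (condComplexity U y x).toNat

theorem IsOptimalPrefixFreeMachine.exists_natComplexity_bound {U : Str → Str →. Str}
    (hU : IsOptimalPrefixFreeMachine U) :
    ∃ c : ℕ, ∀ x y, condComplexity U y x ≤ (encode y + c : ℕ) := by
  obtain ⟨c, hc⟩ := hU.condComplexity_le isRequestFamily_encode
  refine ⟨1 + c, fun x y => ?_⟩
  rw [← add_assoc]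
  exact hc x y _ rfl

theorem IsOptimalPrefixFreeMachine.coe_natComplexity {U : Str → Str →. Str}
    (hU : IsOptimalPrefixFreeMachine U) (y x : Str) :
    (natComplexity U y x : ℕ∞) = condComplexity U y x := by
  obtain ⟨c, hc⟩ := hU.exists_natComplexity_bound
  exact ENat.natCast_toNat (ne_top_of_le_ne_top (ENat.natCast_ne_top _) (hc x y))

theorem IsOptimalPrefixFreeMachine.maxComplexity_eq {U : Str → Str →. Str}
    (hU : IsOptimalPrefixFreeMachine U) (x y : Str) :
    maxComplexity U x y = (max (natComplexity U x y) (natComplexity U y x) : ℕ) := by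
  rw [maxComplexity, ← hU.coe_natComplexity, ← hU.coe_natComplexity]
  norm_cast

theorem IsOptimalPrefixFreeMachine.natComplexity_le {U : Str → Str →. Str}
    (hU : IsOptimalPrefixFreeMachine U) {P : Str → Str → ℕ → Prop}
    (hP : IsRequestFamily P) : ∃ c : ℕ, ∀ x y k, P x y k → natComplexity U y x ≤ k + c := by
  obtain ⟨c, hc⟩ := hU.condComplexity_le hP
  refine ⟨c, fun x y k h => ?_⟩
  have := hc x y k h
  rw [← hU.coe_natComplexity] at this
  exact_mod_cast this

theorem IsOptimalPrefixFreeMachine.sum_natComplexity_le_one {U : Str → Str →. Str}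
    (hU : IsOptimalPrefixFreeMachine U) (x : Str) (F : Finset Str) :
    ∑ y ∈ F, (2⁻¹ : ℝ) ^ natComplexity U y x ≤ 1 := by
  choose p hp hl using fun y => exists_mem_of_condComplexity_eq (hU.coe_natComplexity y x).symm
  simp only [← hl]
  refine hU.1.kraft x (fun y _ => Part.dom_iff_mem.2 ⟨y, hp y⟩) fun y _ z _ hyz => ?_
  exact Part.mem_unique (hp y) (hyz ▸ hp z)

/-- The complexity is the limit of a computable nonincreasing sequence. -/
theorem IsOptimalPrefixFreeMachine.exists_approximation {U : Str → Str →. Str}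
    (hU : IsOptimalPrefixFreeMachine U) :
    ∃ h : (Str × Str) × ℕ → ℕ, Computable h ∧ (∀ a, Antitone fun n => h (a, n)) ∧
      ∀ a, ∀ᶠ n in atTop, h (a, n) = natComplexity U a.1 a.2 := by
  obtain ⟨c, hc⟩ := hU.exists_natComplexity_bound
  obtain ⟨f, hf, hfP⟩ := hU.1.isRequestFamily.re
  -- Stage n is read as a pair (length, witness); a confirmed program length may lower the current
  -- estimate.
  let step (a : Str × Str) (n r : ℕ) : ℕ :=
    bif f ((a.2, a.1, n.unpair.1), n.unpair.2) then min n.unpair.1 r else r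
  let h (b : (Str × Str) × ℕ) : ℕ := Nat.rec (encode b.1.1 + c) (fun n r => step b.1 n r) b.2
  have hsucc : ∀ a n, h (a, n + 1) = step a n (h (a, n)) := fun _ _ => rfl
  have hle : ∀ a n r, step a n r ≤ r := by
    intro a n r
    simp only [step]
    cases f ((a.2, a.1, n.unpair.1), n.unpair.2) <;> simp
  have hanti : ∀ a, Antitone fun n => h (a, n) := fun a =>
    antitone_nat_of_succ_le fun n => by rw [hsucc]; exact hle _ _ _
  have hbound : ∀ a n, natComplexity U a.1 a.2 ≤ h (a, n) := by
    intro a n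
    induction n with
    | zero =>
      have := hc a.2 a.1
      rw [← hU.coe_natComplexity] at this
      exact_mod_cast this
    | succ n ih =>
      rw [hsucc]
      simp only [step]
      cases hfn : f ((a.2, a.1, n.unpair.1), n.unpair.2) with
      | false => exact ih
      | true =>
        obtain ⟨p, hp, hl⟩ := (hfP a.2 a.1 n.unpair.1).2 ⟨_, hfn⟩
        have := condComplexity_le_of_mem hp
        rw [hl, ← hU.coe_natComplexity] at this
        exact le_min (by exact_mod_cast this) ih
  refine ⟨h, ?_, hanti, fun a => ?_⟩
  · refine Computable.nat_rec (f := fun b : (Str × Str) × ℕ => b.2)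
      (g := fun b : (Str × Str) × ℕ => encode b.1.1 + c) (h := fun b s => step b.1 s.1 s.2)
      Computable.snd (Primrec.nat_add.to_comp.comp (Computable.encode.comp
        (Computable.fst.comp Computable.fst)) (Computable.const c)) ?_
    unfold Computable₂
    have ha : Computable fun b : ((Str × Str) × ℕ) × (ℕ × ℕ) => b.1.1 :=
      Computable.fst.comp Computable.fst
    have hn : Computable fun b : ((Str × Str) × ℕ) × (ℕ × ℕ) => b.2.1.unpair :=
      Computable.unpair.comp (Computable.fst.comp Computable.snd)
    have hr : Computable fun b : ((Str × Str) × ℕ) × (ℕ × ℕ) => b.2.2 :=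
      Computable.snd.comp Computable.snd
    exact Computable.cond (hf.comp (((Computable.snd.comp ha).pair
      ((Computable.fst.comp ha).pair (Computable.fst.comp hn))).pair (Computable.snd.comp hn)))
      (Primrec.nat_min.to_comp.comp (Computable.fst.comp hn) hr) hr
  · obtain ⟨p, hp, hl⟩ := exists_mem_of_condComplexity_eq (hU.coe_natComplexity a.1 a.2).symm
    obtain ⟨s, hs⟩ := (hfP a.2 a.1 (natComplexity U a.1 a.2)).1 ⟨p, hp, hl⟩
    filter_upwards [eventually_ge_atTop (Nat.pair (natComplexity U a.1 a.2) s + 1)] with n hn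
    refine le_antisymm ((hanti a hn).trans ?_) (hbound a n)
    simp only [hsucc, step, Nat.unpair_pair, hs, cond_true]
    exact min_le_left _ _

theorem IsOptimalPrefixFreeMachine.isCondSemimeasure {U : Str → Str →. Str}
    (hU : IsOptimalPrefixFreeMachine U) :
    IsCondSemimeasure fun x y => (2⁻¹ : ℝ) ^ natComplexity U x y where
  lowerSemicomputable := by
    obtain ⟨h, hh, hanti, hlim⟩ := hU.exists_approximation
    have hpow : Computable fun b => 2 ^ h b := (primrec_two_pow Primrec.id).to_comp.comp hh
    refine ⟨_, computableRat_of_nat (Computable.const 1) hpow fun b => by positivity,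
      fun a i j hij => ?_, fun a => ?_⟩
    · have := hanti a hij
      simp only [Nat.cast_one, Nat.cast_pow, Nat.cast_ofNat]
      gcongr
      norm_num
    · refine tendsto_const_nhds.congr' ?_
      filter_upwards [hlim a] with n hn
      simp [hn]
  nonneg x y := by positivity
  summable y := summable_of_sum_le (fun x => by positivity) (hU.sum_natComplexity_le_one y)
  sum_le_one y :=
    Real.tsum_le_of_sum_le (fun x => by positivity) (hU.sum_natComplexity_le_one y)

/-- The coding theorem: a semimeasure is dominated by the exponential of minus the complexity. -/
theorem IsOptimalPrefixFreeMachine.exists_semimeasure_le {U : Str → Str →. Str}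
    (hU : IsOptimalPrefixFreeMachine U) {m : Str → Str → ℝ} (hm : IsCondSemimeasure m) :
    ∃ c : ℝ, 0 < c ∧ ∀ x y, m x y ≤ c * 2⁻¹ ^ natComplexity U x y := by
  obtain ⟨g, hg, hgP⟩ := hm.lowerSemicomputable.two_inv_pow_lt fun a => hm.nonneg _ _
  have hre : ∃ f : (Str × Str × ℕ) × ℕ → Bool, Computable f ∧
      ∀ x y k, (2⁻¹ : ℝ) ^ k < m y x ↔ ∃ n, f ((x, y, k), n) = true := by
    refine ⟨fun b => g (((b.1.2.1, b.1.1), b.1.2.2), b.2), hg.comp ?_, fun x y k => hgP (y, x) k⟩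
    exact ((((Computable.fst.comp (Computable.snd.comp Computable.fst)).pair
      (Computable.fst.comp Computable.fst)).pair
      (Computable.snd.comp (Computable.snd.comp Computable.fst))).pair Computable.snd)
  obtain ⟨c, hc⟩ := hU.natComplexity_le (isRequestFamily_succ (w := fun x y => m y x) hre
    (fun x y => hm.nonneg y x) hm.summable hm.sum_le_one fun x y k h => h.le)
  -- If KP < c + 2, the bound m ≤ 1 suffices. If KP = k + c + 2 and m > 2^(-k), the shifted request
  -- of length k + 1 would give KP ≤ k + 1 + c.
  refine ⟨2 ^ (c + 2), by positivity, fun x y => ?_⟩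
  rcases lt_or_ge (natComplexity U x y) (c + 2) with hlt | hge
  · have h1 : m x y ≤ 1 := ((hm.summable y).le_tsum x fun z _ => hm.nonneg z y).trans
      (hm.sum_le_one y)
    refine h1.trans ?_
    rw [inv_pow, ← div_eq_mul_inv, one_le_div (by positivity)]
    exact pow_le_pow_right₀ one_le_two hlt.le
  · obtain ⟨k, hk⟩ := Nat.exists_eq_add_of_le' hge
    rw [hk, pow_add (2⁻¹ : ℝ), mul_left_comm, ← mul_pow]
    by_contra! hlt
    have := hc y x (k + 1) ⟨by omega, by simpa using hlt⟩
    omega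

theorem two_rpow_neg_natCast (n : ℕ) : (2 : ℝ) ^ (-(n : ℝ)) = 2⁻¹ ^ n := by
  rw [Real.rpow_neg zero_le_two, Real.rpow_natCast, inv_pow]

theorem IsAdmissibleDistance.nonneg {D : Str → Str → ℝ} (hD : IsAdmissibleDistance D)
    (x y : Str) : 0 ≤ D x y := by
  have h : (2 : ℝ) ^ (-D x y) ≤ 1 := ((hD.summable x).le_tsum y fun z _ => by positivity).trans
    (hD.sum_le_one x)
  by_contra! hneg
  exact absurd h (not_le.2 (Real.one_lt_rpow one_lt_two (by linarith)))

theorem IsOptimalPrefixFreeMachine.exists_natComplexity_le_distance {U : Str → Str →. Str}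
    (hU : IsOptimalPrefixFreeMachine U) {D : Str → Str → ℝ} (hD : IsAdmissibleDistance D) :
    ∃ c : ℝ, ∀ x y, (natComplexity U y x : ℝ) ≤ D x y + c := by
  obtain ⟨g, hg, hgP⟩ := hD.upperSemicomputable.exists_le
  have hre : ∃ f : (Str × Str × ℕ) × ℕ → Bool, Computable f ∧
      ∀ x y k, (∃ n, g (((x, y), k), n) = true) ↔ ∃ n, f ((x, y, k), n) = true := by
    refine ⟨fun b => g (((b.1.1, b.1.2.1), b.1.2.2), b.2), hg.comp ?_, fun x y k => Iff.rfl⟩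
    exact (((Computable.fst.comp Computable.fst).pair
      (Computable.fst.comp (Computable.snd.comp Computable.fst))).pair
      (Computable.snd.comp (Computable.snd.comp Computable.fst))).pair Computable.snd
  obtain ⟨c, hc⟩ := hU.natComplexity_le (isRequestFamily_succ (w := fun x y => 2 ^ (-D x y)) hre
    (fun x y => by positivity) hD.summable hD.sum_le_one fun x y k h => by
      rw [← two_rpow_neg_natCast]
      have : D x y ≤ k := (hgP (x, y) k).2 h
      exact Real.rpow_le_rpow_of_exponent_le one_le_two (by linarith))
  -- One unit comes from rounding D up to an integer strictly above it, the other from the shift in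
  -- `isRequestFamily_succ`.
  refine ⟨c + 2, fun x y => ?_⟩
  have hlt : D x y < (⌊D x y⌋₊ + 1 : ℕ) := by
    push_cast
    exact Nat.lt_floor_add_one _
  have h1 := hc x y (⌊D x y⌋₊ + 1 + 1) ⟨by omega, (hgP (x, y) _).1 hlt⟩
  have h2 : (natComplexity U y x : ℝ) ≤ ⌊D x y⌋₊ + 1 + 1 + c := by exact_mod_cast h1
  linarith [Nat.floor_le (hD.nonneg x y)]

theorem IsOptimalPrefixFreeMachine.isMaximalCondSemimeasure {U : Str → Str →. Str}
    (hU : IsOptimalPrefixFreeMachine U) :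
    IsMaximalCondSemimeasure fun x y => (2⁻¹ : ℝ) ^ natComplexity U x y :=
  ⟨hU.isCondSemimeasure, fun _ hm => hU.exists_semimeasure_le hm⟩

/-! ### The extremal symmetric functions -/

theorem IsMaximalCondSemimeasure.isMaximalSymmSemimeasure {m : Str → Str → ℝ}
    (hm : IsMaximalCondSemimeasure m) :
    IsMaximalSymmSemimeasure fun x y => min (m x y) (m y x) := by
  have h0 : ∀ x y, 0 ≤ min (m x y) (m y x) := fun x y =>
    le_min (hm.1.nonneg x y) (hm.1.nonneg y x)
  have hs : ∀ x, Summable fun y => min (m x y) (m y x) := fun x =>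
    (hm.1.summable x).of_nonneg_of_le (h0 x) fun y => min_le_right _ _
  refine ⟨⟨fun x y => min_comm _ _, ?_, h0, hs, fun x => ?_⟩, fun v hv => ?_⟩
  · exact lowerSemicomputable_min hm.1.lowerSemicomputable
      (hm.1.lowerSemicomputable.comp (Computable.snd.pair Computable.fst))
      (fun a => hm.1.nonneg _ _) (fun a => hm.1.nonneg _ _)
  · exact ((hs x).tsum_le_tsum (fun y => min_le_right _ _) (hm.1.summable x)).trans
      (hm.1.sum_le_one x)
  · have hswap : ∀ y, (fun x => v x y) = fun x => v y x := fun y => funext fun x => hv.symm x y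
    obtain ⟨c, hc, h⟩ := hm.2 v ⟨hv.lowerSemicomputable, hv.nonneg,
      fun y => by rw [hswap]; exact hv.summable y, fun y => by rw [hswap]; exact hv.sum_le_one y⟩
    refine ⟨c, hc, fun x y => ?_⟩
    rw [mul_min_of_nonneg _ _ hc.le]
    exact le_min (h x y) (hv.symm x y ▸ h y x)

theorem IsMaximalSymmSemimeasure.exists_le_and_le {u v : Str → Str → ℝ}
    (hu : IsMaximalSymmSemimeasure u) (hv : IsMaximalSymmSemimeasure v) :
    ∃ c : ℝ, 0 < c ∧ ∀ x y, u x y ≤ c * v x y ∧ v x y ≤ c * u x y := by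
  obtain ⟨c, hc, h⟩ := hv.2 u hu.1
  obtain ⟨d, _, h'⟩ := hu.2 v hv.1
  refine ⟨max c d, lt_max_of_lt_left hc, fun x y => ⟨(h x y).trans ?_, (h' x y).trans ?_⟩⟩
  · exact mul_le_mul_of_nonneg_right (le_max_left c d) (hv.1.nonneg x y)
  · exact mul_le_mul_of_nonneg_right (le_max_right c d) (hu.1.nonneg x y)

theorem IsOptimalPrefixFreeMachine.toNat_maxComplexity {U : Str → Str →. Str}
    (hU : IsOptimalPrefixFreeMachine U) (x y : Str) :
    (maxComplexity U x y).toNat = max (natComplexity U x y) (natComplexity U y x) := by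
  rw [hU.maxComplexity_eq, ENat.toNat_natCast]

theorem IsOptimalPrefixFreeMachine.isMinimalAdmissibleDistance {U : Str → Str →. Str}
    (hU : IsOptimalPrefixFreeMachine U) :
    IsMinimalAdmissibleDistance fun x y => ((maxComplexity U x y).toNat : ℝ) := by
  simp only [hU.toNat_maxComplexity]
  have hle : ∀ x y, (2⁻¹ : ℝ) ^ max (natComplexity U x y) (natComplexity U y x) ≤
      2⁻¹ ^ natComplexity U y x := fun x y =>
    pow_le_pow_of_le_one (by norm_num) (by norm_num) (le_max_right _ _)
  have hs : ∀ x, Summable fun y =>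
      (2⁻¹ : ℝ) ^ max (natComplexity U x y) (natComplexity U y x) := fun x =>
    (hU.isCondSemimeasure.summable x).of_nonneg_of_le (fun y => by positivity) (hle x)
  refine ⟨⟨fun x y => by rw [max_comm], ?_, fun x => ?_, fun x => ?_⟩, fun D hD => ?_⟩
  · obtain ⟨h, hh, hanti, hlim⟩ := hU.exists_approximation
    have hswap : Computable fun b : (Str × Str) × ℕ => ((b.1.2, b.1.1), b.2) :=
      ((Computable.snd.comp Computable.fst).pair (Computable.fst.comp Computable.fst)).pair
        Computable.snd
    refine ⟨_, computableRat_of_nat (Primrec.nat_max.to_comp.comp hh (hh.comp hswap))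
      (Computable.const 1) fun _ => one_ne_zero, fun a i j hij => ?_, fun a => ?_⟩
    · have h1 := hanti a hij
      have h2 := hanti (a.2, a.1) hij
      simp only [Nat.cast_one, div_one, Nat.cast_le]
      exact max_le_max h1 h2
    · refine tendsto_const_nhds.congr' ?_
      filter_upwards [hlim a, hlim (a.2, a.1)] with n h1 h2
      simp [h1, h2]
  · simpa only [two_rpow_neg_natCast] using hs x
  · simp only [two_rpow_neg_natCast]
    exact ((hs x).tsum_le_tsum (hle x) (hU.isCondSemimeasure.summable x)).trans
      (hU.isCondSemimeasure.sum_le_one x)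
  · obtain ⟨c, hc⟩ := hU.exists_natComplexity_le_distance hD
    refine ⟨c, fun x y => ?_⟩
    simp only [Nat.cast_max]
    exact max_le (hD.symm x y ▸ hc y x) (hc x y)

theorem IsMinimalAdmissibleDistance.exists_abs_sub_le {D E : Str → Str → ℝ}
    (hD : IsMinimalAdmissibleDistance D) (hE : IsMinimalAdmissibleDistance E) :
    ∃ c : ℝ, ∀ x y, |D x y - E x y| ≤ c := by
  obtain ⟨c, hc⟩ := hD.2 E hE.1
  obtain ⟨d, hd⟩ := hE.2 D hD.1
  refine ⟨max c d, fun x y => abs_le.2 ⟨?_, ?_⟩⟩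
  · linarith [hd x y, le_max_right c d]
  · linarith [hc x y, le_max_left c d]

theorem IsOptimalPrefixFreeMachine.two_rpow_neg_maxComplexity {U : Str → Str →. Str}
    (hU : IsOptimalPrefixFreeMachine U) (x y : Str) :
    (2 : ℝ) ^ (-((maxComplexity U x y).toNat : ℝ)) =
      min (2⁻¹ ^ natComplexity U x y) (2⁻¹ ^ natComplexity U y x) := by
  rw [two_rpow_neg_natCast, hU.toNat_maxComplexity]
  exact (pow_right_anti₀ (by norm_num) (by norm_num) : Antitone fun n => (2⁻¹ : ℝ) ^ n).map_max

end InfoDist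

theorem mainTheorem7 :
    -- maximal conditional semimeasures and optimal prefix-free machines exist
    (∃ m, InfoDist.IsMaximalCondSemimeasure m) ∧
    (∃ U, InfoDist.IsOptimalPrefixFreeMachine U) ∧
    -- `min (m(x|y), m(y|x))` is the maximal element, up to a constant factor
    (∀ m, InfoDist.IsMaximalCondSemimeasure m →
      InfoDist.IsMaximalSymmSemimeasure (fun x y => min (m x y) (m y x)) ∧
      ∀ u, InfoDist.IsMaximalSymmSemimeasure u →
        ∃ c : ℝ, 0 < c ∧ ∀ x y,
          u x y ≤ c * min (m x y) (m y x) ∧ min (m x y) (m y x) ≤ c * u x y) ∧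
    -- `max (KP(x|y), KP(y|x))` is finite and is the minimal element, up to an additive constant
    (∀ U, InfoDist.IsOptimalPrefixFreeMachine U →
      (∀ x y, InfoDist.maxComplexity U x y ≠ ⊤) ∧
      InfoDist.IsMinimalAdmissibleDistance
        (fun x y => ((InfoDist.maxComplexity U x y).toNat : ℝ)) ∧
      ∀ D, InfoDist.IsMinimalAdmissibleDistance D →
        ∃ c : ℝ, ∀ x y, |D x y - ((InfoDist.maxComplexity U x y).toNat : ℝ)| ≤ c) ∧
    -- the two extremal functions correspond to each other under `u = 2^(-D)`
    (∀ m U, InfoDist.IsMaximalCondSemimeasure m → InfoDist.IsOptimalPrefixFreeMachine U →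
      ∃ c : ℝ, 0 < c ∧ ∀ x y,
        (2 : ℝ) ^ (-((InfoDist.maxComplexity U x y).toNat : ℝ)) ≤ c * min (m x y) (m y x) ∧
        min (m x y) (m y x) ≤ c * (2 : ℝ) ^ (-((InfoDist.maxComplexity U x y).toNat : ℝ))) := by
  have hU₀ := InfoDist.isOptimalPrefixFreeMachine_univ
  refine ⟨⟨_, hU₀.isMaximalCondSemimeasure⟩, ⟨_, hU₀⟩,
    fun m hm => ⟨hm.isMaximalSymmSemimeasure,
      fun u hu => hu.exists_le_and_le hm.isMaximalSymmSemimeasure⟩,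
    fun U hU => ⟨fun x y => ?_, hU.isMinimalAdmissibleDistance,
      fun D hD => hD.exists_abs_sub_le hU.isMinimalAdmissibleDistance⟩, fun m U hm hU => ?_⟩
  · rw [hU.maxComplexity_eq]
    exact ENat.natCast_ne_top _
  -- Both functions are now minima built from maximal conditional semimeasures, so uniqueness in (a)
  -- compares them.
  · simp only [hU.two_rpow_neg_maxComplexity]
    exact hU.isMaximalCondSemimeasure.isMaximalSymmSemimeasure.exists_le_and_le
      hm.isMaximalSymmSemimeasure
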